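/- Let $G$ and $H$ be locally compact, second countable, Hausdorff topological groups, and let $K\subseteq G$ and $L\subseteq H$ be compact sets that generate $G$ and $H$ as abstract groups, respectively (so $G$ and $H$ are compactly generated). Let $\rho_K(g,g')$ be the least $n\ge 0$ such that $g^{-1}g'$ is a product of $n$ elements of $K\cup K^{-1}$, and define $\rho_L$ on $H$ likewise. Then $(G,\rho_K)$ and $(H,\rho_L)$ are quasi-isometric if and only if $G$ and $H$ admit a topological coupling. Here a quasi-isometry $(G,\rho_K)\to(H,\rho_L)$ is a map $\phi\colon G\to H$ for which there are constants $\lambda\ge 1$ and $C\ge 0$ such that $$\lambda^{-1}\rho_K(x,z)-C\;\le\;\rho_L(\phi(x),\phi(z))\;\le\;\lambda\,\rho_K(x,z)+C\qquad\text{for all }x,z\in G,$$ and every $y\in H$ satisfies $\rho_L(y,\phi(x))\le C$ for some $x\in G$; the two spaces are quasi-isometric if such a map exists. A topological coupling of $G$ and $H$ is a nonempty locally compact Hausdorff space $X$ with a (jointly) continuous left action of $G$ and a (jointly) continuous right action of $H$ that commute, such that * (properness) for every compact $C\subseteq X$, the sets $\{g\in G: gC\cap C\ne\emptyset\}$ and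 $\{h\in H: Ch\cap C\ne\emptyset\}$ are compact; * (cocompactness) there is a compact $C\subseteq X$ with $X=G\cdot C=C\cdot H$. -/

import Mathlib

open scoped Pointwise

universe u v w

/-- Word length of `g` with respect to `K`: the least length of a word in `K ∪ K⁻¹` with
product `g`. (Meaningful when `K` generates the group.) -/
noncomputable def wordLength {G : Type u} [Group G] (K : Set G) (g : G) : ℕ :=
  sInf {n : ℕ | ∃ l : List G, l.length = n ∧ (∀ x ∈ l, x ∈ K ∪ K⁻¹) ∧ l.prod = g}

/-- The left-invariant word metric `ρ_K(g, h) = |g⁻¹ h|_K`. -/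
noncomputable def wordDist {G : Type u} [Group G] (K : Set G) (g h : G) : ℝ :=
  wordLength K (g⁻¹ * h)

/-- `φ` is a quasi-isometry from `α` with the distance function `dα` to `β` with the distance
function `dβ`: affine lower and upper bounds, and cobounded image. -/
def IsQuasiIsometry {α : Type u} {β : Type v} (dα : α → α → ℝ) (dβ : β → β → ℝ)
    (φ : α → β) : Prop :=
  ∃ L C : ℝ, 1 ≤ L ∧ 0 ≤ C ∧
    (∀ x z : α, L⁻¹ * dα x z - C ≤ dβ (φ x) (φ z) ∧ dβ (φ x) (φ z) ≤ L * dα x z + C) ∧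
    ∀ y : β, ∃ x : α, dβ y (φ x) ≤ C

/-- The space `X`, with a left action of `G` and a right action of `H` (that is, an action of
`Hᵐᵒᵖ`), is a topological coupling of `G` and `H`. -/
structure IsTopologicalCoupling (G : Type u) (H : Type v) (X : Type w)
    [Group G] [TopologicalSpace G] [Group H] [TopologicalSpace H]
    [TopologicalSpace X] [MulAction G X] [MulAction Hᵐᵒᵖ X] : Prop where
  nonempty : Nonempty X
  t2Space : T2Space X
  locallyCompactSpace : LocallyCompactSpace X
  continuous_left : Continuous fun p : G × X => p.1 • p.2
  continuous_right : Continuous fun p : X × H => MulOpposite.op p.2 • p.1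
  comm : ∀ (g : G) (h : H) (x : X),
    g • (MulOpposite.op h • x) = MulOpposite.op h • (g • x)
  proper_left : ∀ C : Set X, IsCompact C → IsCompact {g : G | ((g • C) ∩ C).Nonempty}
  proper_right : ∀ C : Set X, IsCompact C →
    IsCompact {h : H | ((MulOpposite.op h • C) ∩ C).Nonempty}
  cocompact : ∃ C : Set X, IsCompact C ∧
    (⋃ g : G, g • C) = Set.univ ∧ (⋃ h : H, MulOpposite.op h • C) = Set.univ

/-- `G` and `H` admit a topological coupling (on a space in the universe `w`). -/
def AdmitTopologicalCoupling (G : Type u) (H : Type v)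
    [Group G] [TopologicalSpace G] [Group H] [TopologicalSpace H] : Prop :=
  ∃ (X : Type w) (_ : TopologicalSpace X) (_ : MulAction G X) (_ : MulAction Hᵐᵒᵖ X),
    IsTopologicalCoupling G H X

/-! From a coupling, fix a point `x₀` and a compact `C` whose translates under either group cover
`X`, and relate `g` to `h` when `g⁻¹ x₀ h ∈ C`. Cocompactness makes this relation total on both
sides. Properness bounds its jumps along generators (`wordLength_le_of_relation`), so any choice
function for it is a quasi-isometry. This needs word length to be bounded on compact sets, which is
a Baire category argument.

Conversely, graphs of quasi-isometries themselves do not form a good space, since the maps need not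
be continuous. They are replaced by kernels `f : G → H → [0, 1]` concentrated near a graph, with
uniform coarse constants and a uniform modulus of continuity. Both groups act by translation.
Equicontinuity makes pointwise convergence behave like locally uniform convergence, so the kernels
form a closed subset of a cube (`isClosed_setOf_isCoarseKernel`). Removing the zero kernel leaves a
locally compact space on which both actions are proper and cocompact. A bump around the graph of a
quasi-isometry shows that this space is nonempty. -/

open Filter Topology

/-! ### Word length and its boundedness on compact sets. -/

section WordLength

variable {G : Type u} [Group G] {K : Set G}

theorem exists_word_length_eq (hK : Subgroup.closure K = ⊤) (g : G) :
    ∃ l : List G, l.length = wordLength K g ∧ (∀ x ∈ l, x ∈ K ∪ K⁻¹) ∧ l.prod = g := by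
  have hg : g ∈ (Subgroup.closure K).toSubmonoid := hK ▸ Subgroup.mem_top g
  rw [Subgroup.closure_toSubmonoid] at hg
  obtain ⟨l, hl, hp⟩ := Submonoid.exists_list_of_mem_closure hg
  have hne : {n : ℕ | ∃ l : List G, l.length = n ∧ (∀ x ∈ l, x ∈ K ∪ K⁻¹) ∧ l.prod = g}.Nonempty :=
    ⟨l.length, l, rfl, hl, hp⟩
  exact Nat.sInf_mem hne

theorem wordLength_prod_le (l : List G) (hl : ∀ x ∈ l, x ∈ K ∪ K⁻¹) :
    wordLength K l.prod ≤ l.length :=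
  Nat.sInf_le ⟨l, rfl, hl, rfl⟩

theorem wordLength_one : wordLength K (1 : G) = 0 :=
  Nat.le_zero.1 (wordLength_prod_le (K := K) [] (by simp))

theorem wordLength_le_one {g : G} (hg : g ∈ K ∪ K⁻¹) : wordLength K g ≤ 1 := by
  simpa using wordLength_prod_le (K := K) [g] (by simpa using hg)

theorem wordLength_mul_le (hK : Subgroup.closure K = ⊤) (g h : G) :
    wordLength K (g * h) ≤ wordLength K g + wordLength K h := by
  obtain ⟨l, hl, hl', rfl⟩ := exists_word_length_eq hK g
  obtain ⟨m, hm, hm', rfl⟩ := exists_word_length_eq hK h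
  rw [← hl, ← hm, ← List.prod_append, ← List.length_append]
  refine wordLength_prod_le _ fun x hx => ?_
  rcases List.mem_append.1 hx with hx | hx
  exacts [hl' x hx, hm' x hx]

theorem wordLength_inv_le (hK : Subgroup.closure K = ⊤) (g : G) :
    wordLength K g⁻¹ ≤ wordLength K g := by
  obtain ⟨l, hl, hl', rfl⟩ := exists_word_length_eq hK g
  rw [← hl, List.prod_inv_reverse]
  refine (wordLength_prod_le _ fun x hx => ?_).trans (by simp)
  simp only [List.mem_reverse, List.mem_map] at hx
  obtain ⟨y, hy, rfl⟩ := hx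
  simpa [or_comm] using hl' y hy

theorem wordLength_inv (hK : Subgroup.closure K = ⊤) (g : G) :
    wordLength K g⁻¹ = wordLength K g :=
  (wordLength_inv_le hK g).antisymm (by simpa using wordLength_inv_le hK g⁻¹)

theorem wordLength_inv_mul_comm (hK : Subgroup.closure K = ⊤) (g h : G) :
    wordLength K (g⁻¹ * h) = wordLength K (h⁻¹ * g) := by
  rw [← wordLength_inv hK, mul_inv_rev, inv_inv]

theorem wordLength_inv_mul_le (hK : Subgroup.closure K = ⊤) (x y z : G) :
    wordLength K (x⁻¹ * z) ≤ wordLength K (x⁻¹ * y) + wordLength K (y⁻¹ * z) := by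
  simpa [mul_assoc] using wordLength_mul_le hK (x⁻¹ * y) (y⁻¹ * z)

theorem exists_mul_of_wordLength_eq_succ (hK : Subgroup.closure K = ⊤) {g : G} {n : ℕ}
    (hg : wordLength K g = n + 1) :
    ∃ s t : G, s ∈ K ∪ K⁻¹ ∧ wordLength K t ≤ n ∧ g = s * t := by
  obtain ⟨l, hl, hl', rfl⟩ := exists_word_length_eq hK g
  rw [hg] at hl
  obtain ⟨s, m, rfl⟩ := List.exists_cons_of_length_eq_add_one hl
  refine ⟨s, m.prod, hl' s (by simp), ?_, by simp⟩
  refine (wordLength_prod_le _ fun x hx => hl' x (by simp [hx])).trans ?_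
  simpa using hl.le

theorem setOf_wordLength_le_zero (hK : Subgroup.closure K = ⊤) :
    {g : G | wordLength K g ≤ 0} = {1} := by
  ext g
  constructor
  · intro hg
    obtain ⟨l, hl, -, rfl⟩ := exists_word_length_eq hK g
    rw [Nat.le_zero.1 hg, List.length_eq_zero_iff] at hl
    simp [hl]
  · rintro rfl
    exact wordLength_one.le

/-- Adjoining `1` to the generators turns spheres into balls, so each ball is a product of compact
sets. -/
theorem setOf_wordLength_le_succ (hK : Subgroup.closure K = ⊤) (n : ℕ) :
    {g : G | wordLength K g ≤ n + 1} =
      insert 1 (K ∪ K⁻¹) * {g : G | wordLength K g ≤ n} := by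
  ext g
  constructor
  · intro hg
    rcases Nat.lt_or_ge n (wordLength K g) with h | h
    · obtain ⟨s, t, hs, ht, rfl⟩ := exists_mul_of_wordLength_eq_succ hK (le_antisymm hg h)
      exact Set.mul_mem_mul (Or.inr hs) ht
    · exact ⟨1, Or.inl rfl, g, h, one_mul g⟩
  · rintro ⟨s, hs, t, ht, rfl⟩
    have ht : wordLength K t ≤ n := ht
    rcases hs with rfl | hs
    · simpa using ht.trans n.le_succ
    · have := wordLength_mul_le hK s t
      have := wordLength_le_one hs
      simp only [Set.mem_ofPred_eq]
      omega

variable [TopologicalSpace G] [IsTopologicalGroup G]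

theorem isCompact_setOf_wordLength_le (hKc : IsCompact K) (hK : Subgroup.closure K = ⊤) (n : ℕ) :
    IsCompact {g : G | wordLength K g ≤ n} := by
  induction n with
  | zero => simp only [setOf_wordLength_le_zero hK, isCompact_singleton]
  | succ n ih =>
    rw [setOf_wordLength_le_succ hK]
    exact ((hKc.union hKc.inv).insert 1).mul ih

/-- In a locally compact group, word length with respect to a compact generating set is bounded on
compact sets. -/
theorem IsCompact.exists_wordLength_le [T2Space G] [LocallyCompactSpace G] (hKc : IsCompact K)
    (hK : Subgroup.closure K = ⊤) {D : Set G} (hD : IsCompact D) :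
    ∃ n : ℕ, ∀ g ∈ D, wordLength K g ≤ n := by
  -- Baire: countably many compact, hence closed, balls cover `G`, so one of them has an interior
  -- point `u`.
  obtain ⟨n, u, hu⟩ := nonempty_interior_of_iUnion_of_closed
    (f := fun n : ℕ => {g : G | wordLength K g ≤ n})
    (fun n => (isCompact_setOf_wordLength_le hKc hK n).isClosed)
    (Set.eq_univ_of_forall fun g => Set.mem_iUnion.2 ⟨_, le_refl (wordLength K g)⟩)
  -- Translating the ball by `u⁻¹` gives a neighbourhood of `1` on which the length is at most `2n`.
  have hone : ∀ᶠ x in nhds (1 : G), wordLength K x ≤ n + n := by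
    have h := (continuous_const_mul u).continuousAt (x := 1)
      (by simpa using mem_interior_iff_mem_nhds.1 hu)
    filter_upwards [h] with x hx
    have hx : wordLength K (u * x) ≤ n := hx
    have hu' : u ∈ {g : G | wordLength K g ≤ n} := interior_subset hu
    rw [Set.mem_ofPred_eq] at hu'
    have := wordLength_mul_le hK u⁻¹ (u * x)
    rw [inv_mul_cancel_left, wordLength_inv hK] at this
    omega
  have hnhds (d : G) : ∀ᶠ x in nhds d, wordLength K x ≤ wordLength K d + (n + n) := by
    have h : Filter.Tendsto (fun x => d⁻¹ * x) (nhds d) (nhds 1) := by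
      simpa using (continuous_const_mul d⁻¹).tendsto d
    filter_upwards [h.eventually hone] with x hx
    have := wordLength_mul_le hK d (d⁻¹ * x)
    rw [mul_inv_cancel_left] at this
    omega
  refine hD.induction_on (p := fun s => ∃ n : ℕ, ∀ g ∈ s, wordLength K g ≤ n) ⟨0, by simp⟩
    (fun s t hst ⟨m, hm⟩ => ⟨m, fun g hg => hm g (hst hg)⟩) ?_
    fun d _ => ⟨_, nhdsWithin_le_nhds (hnhds d), _, fun _ => id⟩
  rintro s t ⟨m, hm⟩ ⟨k, hk⟩
  refine ⟨max m k, fun g hg => ?_⟩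
  rcases hg with hg | hg
  exacts [(hm g hg).trans (le_max_left _ _), (hk g hg).trans (le_max_right _ _)]

end WordLength

/-! ### From a coupling to a quasi-isometry. -/

/-- If a relation between two groups is total and moves boundedly along generators, then it is
coarsely Lipschitz for the word lengths. -/
theorem wordLength_le_of_relation {G : Type u} {H : Type v} [Group G] [Group H] {K : Set G}
    {L : Set H} (hK : Subgroup.closure K = ⊤) (hL : Subgroup.closure L = ⊤) {R : G → H → Prop}
    (hR : ∀ g, ∃ h, R g h) {M : ℕ}
    (hM : ∀ g h s h', s ∈ insert 1 (K ∪ K⁻¹) → R g h → R (g * s) h' → wordLength L (h⁻¹ * h') ≤ M)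
    {g g' : G} {h h' : H} (hgh : R g h) (hgh' : R g' h') :
    wordLength L (h⁻¹ * h') ≤ M * wordLength K (g⁻¹ * g') + M := by
  suffices H : ∀ (n : ℕ) (g : G) (h : H), R g h → wordLength K (g⁻¹ * g') ≤ n →
      wordLength L (h⁻¹ * h') ≤ M * n + M from H _ g h hgh le_rfl
  intro n
  induction n with
  | zero =>
    intro g h hgh hn
    have : g⁻¹ * g' ∈ {g : G | wordLength K g ≤ 0} := hn
    rw [setOf_wordLength_le_zero hK, Set.mem_singleton_iff, inv_mul_eq_one] at this
    subst this
    -- The case `s = 1` compares two partners of the same `g`; this is the source of the additive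
    -- `M`.
    simpa using hM g h 1 h' (Or.inl rfl) hgh (by simpa using hgh')
  | succ n ih =>
    intro g h hgh hn
    have : g⁻¹ * g' ∈ {g : G | wordLength K g ≤ n + 1} := hn
    rw [setOf_wordLength_le_succ hK] at this
    obtain ⟨s, hs, t, ht, hst⟩ := this
    obtain ⟨k, hk⟩ := hR (g * s)
    have h1 := hM g h s k hs hgh hk
    have h2 := ih (g * s) k hk (by
      rw [mul_inv_rev, mul_assoc, ← hst]
      simpa using ht)
    have := wordLength_inv_mul_le hL h k h'
    rw [mul_add, mul_one]
    omega

/-- A topological coupling of compactly generated groups yields a quasi-isometry. -/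
theorem IsTopologicalCoupling.exists_isQuasiIsometry {G : Type u} {H : Type v} {X : Type w}
    [Group G] [TopologicalSpace G] [IsTopologicalGroup G] [T2Space G] [LocallyCompactSpace G]
    [Group H] [TopologicalSpace H] [IsTopologicalGroup H] [T2Space H] [LocallyCompactSpace H]
    [TopologicalSpace X] [MulAction G X] [MulAction Hᵐᵒᵖ X] (hX : IsTopologicalCoupling G H X)
    {K : Set G} (hK : IsCompact K) (hKgen : Subgroup.closure K = ⊤)
    {L : Set H} (hL : IsCompact L) (hLgen : Subgroup.closure L = ⊤) :
    ∃ φ : G → H, IsQuasiIsometry (wordDist K) (wordDist L) φ := by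
  obtain ⟨x₀⟩ := hX.nonempty
  obtain ⟨C, hC, hGC, hCH⟩ := hX.cocompact
  let R : G → H → Prop := fun g h => g⁻¹ • MulOpposite.op h • x₀ ∈ C
  have hR (g : G) : ∃ h, R g h := by
    obtain ⟨h, c, hc, hx⟩ := Set.mem_iUnion.1 (hCH ▸ Set.mem_univ (g⁻¹ • x₀))
    refine ⟨h⁻¹, ?_⟩
    have hx : MulOpposite.op h • c = g⁻¹ • x₀ := hx
    simpa only [R, hX.comm, ← hx, MulOpposite.op_inv, inv_smul_smul] using hc
  have hR' (h : H) : ∃ g, R g h := by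
    obtain ⟨g, c, hc, hx⟩ := Set.mem_iUnion.1 (hGC ▸ Set.mem_univ (MulOpposite.op h • x₀))
    refine ⟨g, ?_⟩
    have hx : g • c = MulOpposite.op h • x₀ := hx
    simpa only [R, ← hx, inv_smul_smul] using hc
  -- Both sides equal `g⁻¹ x₀ h'`: translates by `g⁻¹g'` and by `h⁻¹h'` of the two points that test
  -- `R g' h'` and `R g h`.
  have hstep {g g' : G} {h h' : H} :
      (g⁻¹ * g') • g'⁻¹ • MulOpposite.op h' • x₀ =
        MulOpposite.op (h⁻¹ * h') • g⁻¹ • MulOpposite.op h • x₀ := by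
    rw [hX.comm g⁻¹ h, MulOpposite.op_mul, smul_smul, mul_assoc, smul_smul,
      mul_assoc, ← MulOpposite.op_mul, mul_inv_cancel, mul_inv_cancel, MulOpposite.op_one, mul_one,
      mul_one, hX.comm]
  obtain ⟨M₁, hM₁⟩ : ∃ M : ℕ, ∀ g h s h', s ∈ insert 1 (K ∪ K⁻¹) → R g h → R (g * s) h' →
      wordLength L (h⁻¹ * h') ≤ M := by
    -- When `R g h` and `R (g * s) h'` hold, `h⁻¹h'` moves a point of `C` into `s • C`. One compact
    -- set containing both places lets properness apply.
    have hD : IsCompact (C ∪ (fun p : G × X => p.1 • p.2) '' (insert 1 (K ∪ K⁻¹) ×ˢ C)) :=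
      hC.union ((((hK.union hK.inv).insert 1).prod hC).image hX.continuous_left)
    obtain ⟨n, hn⟩ := IsCompact.exists_wordLength_le hL hLgen (hX.proper_right _ hD)
    refine ⟨n, fun g h s h' hs hgh hgh' => hn _ ⟨_, ⟨_, Or.inl hgh, rfl⟩, Or.inr ?_⟩⟩
    refine ⟨(s, _), ⟨hs, hgh'⟩, ?_⟩
    have := hstep (g := g) (g' := g * s) (h := h) (h' := h')
    rwa [inv_mul_cancel_left] at this
  obtain ⟨M₂, hM₂⟩ : ∃ M : ℕ, ∀ h g t g', t ∈ insert 1 (L ∪ L⁻¹) → R g h → R g' (h * t) →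
      wordLength K (g⁻¹ * g') ≤ M := by
    have hD : IsCompact (C ∪ (fun p : X × H => MulOpposite.op p.2 • p.1) ''
        (C ×ˢ insert 1 (L ∪ L⁻¹))) :=
      hC.union ((hC.prod ((hL.union hL.inv).insert 1)).image hX.continuous_right)
    obtain ⟨n, hn⟩ := IsCompact.exists_wordLength_le hK hKgen (hX.proper_left _ hD)
    refine ⟨n, fun h g t g' ht hgh hgh' => hn _ ⟨_, ⟨_, Or.inl hgh', rfl⟩, Or.inr ?_⟩⟩
    refine ⟨(_, t), ⟨hgh, ht⟩, ?_⟩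
    have := hstep (g := g) (g' := g') (h := h) (h' := h * t)
    rw [inv_mul_cancel_left] at this
    exact this.symm
  have h₁ {g g' h h'} (a : R g h) (b : R g' h') :=
    wordLength_le_of_relation hKgen hLgen hR hM₁ a b
  have h₂ {g g' h h'} (a : R g h) (b : R g' h') :=
    wordLength_le_of_relation hLgen hKgen (R := fun h g => R g h) hR' hM₂ a b
  choose φ hφ using hR
  -- The summand `1` ensures that the multiplicative constant is at least `1`.
  refine ⟨φ, M₁ + M₂ + 1, M₁ + M₂ + 1, ?_, by positivity, fun x z => ⟨?_, ?_⟩, fun y => ?_⟩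
  · have : (0 : ℝ) ≤ M₁ + M₂ := by positivity
    linarith
  · have h : (wordDist K x z : ℝ) ≤ M₂ * wordDist L (φ x) (φ z) + M₂ := by
      unfold wordDist
      exact_mod_cast h₂ (hφ x) (hφ z)
    have h0 : 0 ≤ wordDist L (φ x) (φ z) := Nat.cast_nonneg _
    have hM : (0 : ℝ) < M₁ + M₂ + 1 := by positivity
    have hM₁ : (0 : ℝ) ≤ M₁ := by positivity
    have hM₂ : (0 : ℝ) ≤ M₂ := by positivity
    rw [sub_le_iff_le_add, inv_mul_le_iff₀ hM]
    nlinarith [mul_nonneg hM₁ h0, mul_nonneg hM₂ hM₂, mul_nonneg hM₁ hM₂, mul_nonneg hM₁ hM₁]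
  · have h : (wordDist L (φ x) (φ z) : ℝ) ≤ M₁ * wordDist K x z + M₁ := by
      unfold wordDist
      exact_mod_cast h₁ (hφ x) (hφ z)
    have h0 : 0 ≤ wordDist K x z := Nat.cast_nonneg _
    have hM₂ : (0 : ℝ) ≤ M₂ := by positivity
    nlinarith [mul_nonneg hM₂ h0]
  · obtain ⟨x, hx⟩ := hR' y
    refine ⟨x, ?_⟩
    have h : (wordDist L y (φ x) : ℝ) ≤ M₁ * wordDist K x x + M₁ := by
      unfold wordDist
      exact_mod_cast h₁ hx (hφ x)
    have h0 : wordDist K x x = 0 := by simp [wordDist, wordLength_one]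
    rw [h0] at h
    have hM₂ : (0 : ℝ) ≤ M₂ := by positivity
    linarith

/-! ### Coarse kernels and their translates. -/

/-- Functions `G → H → [0, 1]` supported near the graph of a quasi-isometry: they have modulus of
continuity `W`, `V` for right translations, the support is a coarse correspondence with constant
`A`, and, unless the function vanishes, it attains the value `1` in every row and column. -/
structure IsCoarseKernel {G : Type u} {H : Type v} [Group G] [Group H] (K : Set G) (L : Set H)
    (W : G → ℝ) (V : H → ℝ) (A : ℕ) (f : G → H → unitInterval) : Prop where
  abs_sub_le : ∀ x y x' y', |(f x y : ℝ) - f x' y'| ≤ W (x⁻¹ * x') + V (y⁻¹ * y')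
  coarse : ∀ x y x' y', f x y ≠ 0 → f x' y' ≠ 0 →
    wordLength L (y⁻¹ * y') ≤ A * wordLength K (x⁻¹ * x') + A ∧
    wordLength K (x⁻¹ * x') ≤ A * wordLength L (y⁻¹ * y') + A
  exists_right : ∀ x y x', f x y ≠ 0 → ∃ y', f x' y' = 1
  exists_left : ∀ x y y', f x y ≠ 0 → ∃ x', f x' y' = 1

namespace IsCoarseKernel

variable {G : Type u} {H : Type v} [Group G] [Group H] {K : Set G} {L : Set H}
  {W : G → ℝ} {V : H → ℝ} {A : ℕ} {f : G → H → unitInterval}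

theorem translate_left (hf : IsCoarseKernel K L W V A f) (g : G) :
    IsCoarseKernel K L W V A fun x y => f (g * x) y where
  abs_sub_le x y x' y' := by simpa [mul_assoc] using hf.abs_sub_le (g * x) y (g * x') y'
  coarse x y x' y' h h' := by simpa [mul_assoc] using hf.coarse _ _ _ _ h h'
  exists_right x y x' h := hf.exists_right _ _ (g * x') h
  exists_left x y y' h := by
    obtain ⟨x', hx'⟩ := hf.exists_left _ _ y' h
    exact ⟨g⁻¹ * x', by simpa using hx'⟩

theorem translate_right (hf : IsCoarseKernel K L W V A f) (h : H) :
    IsCoarseKernel K L W V A fun x y => f x (h * y) where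
  abs_sub_le x y x' y' := by simpa [mul_assoc] using hf.abs_sub_le x (h * y) x' (h * y')
  coarse x y x' y' h h' := by simpa [mul_assoc] using hf.coarse _ _ _ _ h h'
  exists_left x y y' hxy := hf.exists_left _ _ (h * y') hxy
  exists_right x y x' hxy := by
    obtain ⟨y', hy'⟩ := hf.exists_right _ _ x' hxy
    exact ⟨h⁻¹ * y', by simpa using hy'⟩

end IsCoarseKernel

/-! ### Closedness of the set of coarse kernels. -/

section Modulus

variable {G : Type u} {H : Type v} [Group G] [Group H]

/-- Functions with given moduli of continuity for right translations. -/
def modulusSet (W : G → ℝ) (V : H → ℝ) : Set (G → H → unitInterval) :=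
  {f | ∀ x y x' y', |(f x y : ℝ) - f x' y'| ≤ W (x⁻¹ * x') + V (y⁻¹ * y')}

theorem isClosed_modulusSet (W : G → ℝ) (V : H → ℝ) : IsClosed (modulusSet W V) := by
  simp only [modulusSet, Set.ofPred_forall]
  refine isClosed_iInter fun x => isClosed_iInter fun y => isClosed_iInter fun x' =>
    isClosed_iInter fun y' => isClosed_le ?_ continuous_const
  fun_prop

variable [TopologicalSpace G] [IsTopologicalGroup G] [TopologicalSpace H] [IsTopologicalGroup H]

/-- Equicontinuity: moving the arguments costs at most `W + V` uniformly in the function, so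
pointwise convergence at `(x₀, y₀)` suffices for joint continuity. -/
theorem continuousOn_eval_modulusSet {W : G → ℝ} {V : H → ℝ} (hW : Tendsto W (𝓝 1) (𝓝 0))
    (hV : Tendsto V (𝓝 1) (𝓝 0)) :
    ContinuousOn (fun p : (G → H → unitInterval) × G × H => p.1 p.2.1 p.2.2)
      (modulusSet W V ×ˢ Set.univ) := by
  rintro ⟨f₀, x₀, y₀⟩ -
  rw [ContinuousWithinAt, tendsto_subtype_rng, tendsto_iff_dist_tendsto_zero]
  have hx : Tendsto (fun p : (G → H → unitInterval) × G × H => W (p.2.1⁻¹ * x₀))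
      (𝓝 (f₀, x₀, y₀)) (𝓝 0) :=
    hW.comp (Continuous.tendsto' (by fun_prop) _ _ (by simp))
  have hy : Tendsto (fun p : (G → H → unitInterval) × G × H => V (p.2.2⁻¹ * y₀))
      (𝓝 (f₀, x₀, y₀)) (𝓝 0) :=
    hV.comp (Continuous.tendsto' (by fun_prop) _ _ (by simp))
  have hf : Tendsto (fun p : (G → H → unitInterval) × G × H => |(p.1 x₀ y₀ : ℝ) - f₀ x₀ y₀|)
      (𝓝 (f₀, x₀, y₀)) (𝓝 0) :=
    Continuous.tendsto' (by fun_prop) _ _ (by simp)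
  have hsum := (hx.add hy).add hf
  simp only [add_zero] at hsum
  refine squeeze_zero' (Eventually.of_forall fun _ => dist_nonneg) ?_
    (hsum.mono_left nhdsWithin_le_nhds)
  filter_upwards [self_mem_nhdsWithin] with p hp
  rw [Real.dist_eq]
  exact (abs_sub_le _ (p.1 x₀ y₀ : ℝ) _).trans (add_le_add_left (hp.1 _ _ _ _) _)

/-- An existential over an infinite set is not closed in general. Here the witnesses lie in the
compact `B`, and the set is the projection of a compact set, since `modulusSet W V` is compact by
Tychonoff. -/
theorem isClosed_modulusSet_exists_eq_one {W : G → ℝ} {V : H → ℝ} (hW : Tendsto W (𝓝 1) (𝓝 0))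
    (hV : Tendsto V (𝓝 1) (𝓝 0)) [T2Space G] [T2Space H] {B : Set (G × H)} (hB : IsCompact B) :
    IsClosed {f ∈ modulusSet W V | ∃ p ∈ B, f p.1 p.2 = 1} := by
  have hc : IsCompact (modulusSet W V ×ˢ B) := (isClosed_modulusSet W V).isCompact.prod hB
  have := ((continuousOn_eval_modulusSet hW hV).mono
    (Set.prod_mono_right (Set.subset_univ B))).preimage_isClosed_of_isClosed hc.isClosed
    (isClosed_singleton (x := (1 : unitInterval)))
  convert ((hc.of_isClosed_subset this Set.inter_subset_left).image continuous_fst).isClosed using 1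
  ext f
  constructor
  · rintro ⟨hf, p, hp, h⟩
    exact ⟨(f, p), ⟨⟨hf, hp⟩, h⟩, rfl⟩
  · rintro ⟨⟨f, p⟩, ⟨⟨hf, hp⟩, h⟩, rfl⟩
    exact ⟨hf, p, hp, h⟩

/-- Each condition has the form "`f x y = 0` or a closed condition". This is why the kernel axioms
test `≠ 0` in their premises and `= 1` in their conclusions. -/
theorem isClosed_setOf_isCoarseKernel [T2Space G] [T2Space H] {K : Set G} (hK : IsCompact K)
    (hKgen : Subgroup.closure K = ⊤) {L : Set H} (hL : IsCompact L)
    (hLgen : Subgroup.closure L = ⊤) {W : G → ℝ} {V : H → ℝ} (hW : Tendsto W (𝓝 1) (𝓝 0))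
    (hV : Tendsto V (𝓝 1) (𝓝 0)) (A : ℕ) :
    IsClosed {f | IsCoarseKernel K L W V A f} := by
  -- The coarse inequalities confine the points where the value `1` is attained to these compact
  -- sets, so adding the restriction loses no kernel.
  let BH (x : G) (y : H) (x' : G) : Set (G × H) := {x'} ×ˢ
    ((fun h => y * h) '' {h | wordLength L h ≤ A * wordLength K (x⁻¹ * x') + A})
  let BG (x : G) (y y' : H) : Set (G × H) :=
    ((fun g => x * g) '' {g | wordLength K g ≤ A * wordLength L (y⁻¹ * y') + A}) ×ˢ {y'}
  have hBH x y x' : IsCompact (BH x y x') := isCompact_singleton.prod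
    ((isCompact_setOf_wordLength_le hL hLgen _).image (continuous_const_mul y))
  have hBG x y y' : IsCompact (BG x y y') :=
    ((isCompact_setOf_wordLength_le hK hKgen _).image (continuous_const_mul x)).prod
      isCompact_singleton
  have hz (x : G) (y : H) : IsClosed {f : G → H → unitInterval | f x y = 0} :=
    isClosed_eq (by fun_prop) continuous_const
  have key : {f | IsCoarseKernel K L W V A f} = modulusSet W V ∩
      ((⋂ x, ⋂ y, ⋂ x', ⋂ y', {f | f x y = 0} ∪ {f | f x' y' = 0} ∪
        {_f | wordLength L (y⁻¹ * y') ≤ A * wordLength K (x⁻¹ * x') + A ∧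
          wordLength K (x⁻¹ * x') ≤ A * wordLength L (y⁻¹ * y') + A}) ∩
      ((⋂ x, ⋂ y, ⋂ x', {f | f x y = 0} ∪ {f ∈ modulusSet W V | ∃ p ∈ BH x y x', f p.1 p.2 = 1}) ∩
      (⋂ x, ⋂ y, ⋂ y', {f | f x y = 0} ∪
        {f ∈ modulusSet W V | ∃ p ∈ BG x y y', f p.1 p.2 = 1}))) := by
    ext f
    simp only [Set.mem_inter_iff, Set.mem_iInter, Set.mem_union, Set.mem_ofPred_eq]
    constructor
    · intro hf
      refine ⟨hf.abs_sub_le, fun x y x' y' => ?_, fun x y x' => ?_, fun x y y' => ?_⟩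
      · have := hf.coarse x y x' y'
        tauto
      · refine or_iff_not_imp_left.2 fun h => ⟨hf.abs_sub_le, ?_⟩
        obtain ⟨y', hy'⟩ := hf.exists_right x y x' h
        exact ⟨(x', y'), ⟨rfl, y⁻¹ * y', (hf.coarse x y x' y' h (by simp [hy'])).1, by simp⟩, hy'⟩
      · refine or_iff_not_imp_left.2 fun h => ⟨hf.abs_sub_le, ?_⟩
        obtain ⟨x', hx'⟩ := hf.exists_left x y y' h
        exact ⟨(x', y'), ⟨⟨x⁻¹ * x', (hf.coarse x y x' y' h (by simp [hx'])).2, by simp⟩, rfl⟩, hx'⟩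
    · rintro ⟨h1, h2, h3, h4⟩
      refine ⟨h1, fun x y x' y' h h' => ?_, fun x y x' h => ?_, fun x y y' h => ?_⟩
      · have := h2 x y x' y'
        tauto
      · obtain ⟨-, ⟨p, q⟩, ⟨hp, -⟩, hpq⟩ := (h3 x y x').resolve_left h
        exact ⟨q, by rwa [← Set.mem_singleton_iff.1 hp]⟩
      · obtain ⟨-, ⟨p, q⟩, ⟨-, hq⟩, hpq⟩ := (h4 x y y').resolve_left h
        exact ⟨p, by rwa [← Set.mem_singleton_iff.1 hq]⟩
  rw [key]
  refine (isClosed_modulusSet W V).inter (IsClosed.inter ?_ (IsClosed.inter ?_ ?_))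
  · exact isClosed_iInter fun x => isClosed_iInter fun y => isClosed_iInter fun x' =>
      isClosed_iInter fun y' => ((hz x y).union (hz x' y')).union isClosed_const
  · exact isClosed_iInter fun x => isClosed_iInter fun y => isClosed_iInter fun x' =>
      (hz x y).union (isClosed_modulusSet_exists_eq_one hW hV (hBH x y x'))
  · exact isClosed_iInter fun x => isClosed_iInter fun y => isClosed_iInter fun y' =>
      (hz x y).union (isClosed_modulusSet_exists_eq_one hW hV (hBG x y y'))

end Modulus

/-- Projection along the compact factor `C` is a closed map. For properness this reduces compactness
of the return set to a bound on word length. -/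
theorem isClosed_setOf_exists_mem_compact {X Y : Type*} [TopologicalSpace X] [T2Space X]
    [TopologicalSpace Y] {act : Y × X → X} (hact : Continuous act) {C : Set X} (hC : IsCompact C) :
    IsClosed {g : Y | ∃ c ∈ C, act (g, c) ∈ C} := by
  have : CompactSpace C := isCompact_iff_compactSpace.1 hC
  have h : IsClosed {p : Y × C | act (p.1, p.2) ∈ C} := hC.isClosed.preimage (by fun_prop)
  convert isClosedMap_fst_of_compactSpace _ h using 1
  ext g
  constructor
  · rintro ⟨c, hc, h⟩
    exact ⟨(g, ⟨c, hc⟩), h, rfl⟩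
  · rintro ⟨⟨g, c, hc⟩, h, rfl⟩
    exact ⟨c, hc, h⟩

/-! ### The coupling space. -/

/-- The space of nonzero coarse kernels, with the topology of pointwise convergence. -/
abbrev CouplingSpace {G : Type u} {H : Type v} [Group G] [Group H] (K : Set G) (L : Set H)
    (W : G → ℝ) (V : H → ℝ) (A : ℕ) : Type (max u v) :=
  {f : G → H → unitInterval // IsCoarseKernel K L W V A f ∧ ∃ x y, f x y ≠ 0}

namespace CouplingSpace

variable {G : Type u} {H : Type v} [Group G] [Group H] {K : Set G} {L : Set H}
  {W : G → ℝ} {V : H → ℝ} {A : ℕ}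

instance : MulAction G (CouplingSpace K L W V A) where
  smul g f := ⟨fun x y => f.1 (g⁻¹ * x) y, f.2.1.translate_left g⁻¹, by
    obtain ⟨x, y, h⟩ := f.2.2
    exact ⟨g * x, y, by simpa using h⟩⟩
  one_smul f := Subtype.ext <| funext fun x => funext fun y =>
    show f.1 (1⁻¹ * x) y = f.1 x y by simp
  mul_smul g g' f := Subtype.ext <| funext fun x => funext fun y =>
    show f.1 ((g * g')⁻¹ * x) y = f.1 (g'⁻¹ * (g⁻¹ * x)) y by simp [mul_assoc]

instance : MulAction Hᵐᵒᵖ (CouplingSpace K L W V A) where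
  smul h f := ⟨fun x y => f.1 x (h.unop * y), f.2.1.translate_right h.unop, by
    obtain ⟨x, y, hxy⟩ := f.2.2
    exact ⟨x, h.unop⁻¹ * y, by simpa using hxy⟩⟩
  one_smul f := Subtype.ext <| funext fun x => funext fun y =>
    show f.1 x (1 * y) = f.1 x y by simp
  mul_smul h h' f := Subtype.ext <| funext fun x => funext fun y =>
    show f.1 x ((h'.unop * h.unop) * y) = f.1 x (h'.unop * (h.unop * y)) by simp [mul_assoc]

theorem smul_apply (g : G) (f : CouplingSpace K L W V A) (x : G) (y : H) :
    (g • f).1 x y = f.1 (g⁻¹ * x) y := rfl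

theorem op_smul_apply (h : H) (f : CouplingSpace K L W V A) (x : G) (y : H) :
    (MulOpposite.op h • f).1 x y = f.1 x (h * y) := rfl

theorem exists_eq_one_right (f : CouplingSpace K L W V A) (x : G) : ∃ y, f.1 x y = 1 := by
  obtain ⟨x', y', h⟩ := f.2.2
  exact f.2.1.exists_right x' y' x h

theorem exists_eq_one_left (f : CouplingSpace K L W V A) (y : H) : ∃ x, f.1 x y = 1 := by
  obtain ⟨x', y', h⟩ := f.2.2
  exact f.2.1.exists_left x' y' y h

/-- The open sets `{f | f 1 y ≠ 0}` cover the space because every row of a nonzero kernel attains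
`1`; finitely many cover `C`. -/
theorem exists_wordLength_le_of_isCompact {C : Set (CouplingSpace K L W V A)} (hC : IsCompact C) :
    ∃ n : ℕ, ∀ f ∈ C, ∃ y, wordLength L y ≤ n ∧ f.1 1 y ≠ 0 := by
  refine hC.induction_on
    (p := fun s => ∃ n : ℕ, ∀ f ∈ s, ∃ y, wordLength L y ≤ n ∧ f.1 1 y ≠ 0) ⟨0, by simp⟩
    (fun s t hst ⟨m, hm⟩ => ⟨m, fun g hg => hm g (hst hg)⟩) ?_ fun f _ => ?_
  · rintro s t ⟨m, hm⟩ ⟨k, hk⟩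
    refine ⟨max m k, fun f hf => ?_⟩
    rcases hf with hf | hf
    · obtain ⟨y, hy, h⟩ := hm f hf
      exact ⟨y, hy.trans (le_max_left _ _), h⟩
    · obtain ⟨y, hy, h⟩ := hk f hf
      exact ⟨y, hy.trans (le_max_right _ _), h⟩
  · obtain ⟨y, hy⟩ := f.exists_eq_one_right 1
    have hopen : IsOpen {f : CouplingSpace K L W V A | f.1 1 y ≠ 0} :=
      isOpen_ne_fun ((continuous_apply_apply 1 y).comp continuous_subtype_val) continuous_const
    exact ⟨_, mem_nhdsWithin_of_mem_nhds (hopen.mem_nhds (by simp [hy])), _,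
      fun f hf => ⟨y, le_rfl, hf⟩⟩

variable [TopologicalSpace G] [IsTopologicalGroup G] [TopologicalSpace H] [IsTopologicalGroup H]

theorem continuous_eval (hW : Tendsto W (𝓝 1) (𝓝 0)) (hV : Tendsto V (𝓝 1) (𝓝 0)) :
    Continuous fun p : CouplingSpace K L W V A × G × H => p.1.1 p.2.1 p.2.2 :=
  (continuousOn_eval_modulusSet hW hV).comp_continuous
    (f := fun p : CouplingSpace K L W V A × G × H => (p.1.1, p.2)) (by fun_prop)
    fun p => ⟨p.1.2.1.abs_sub_le, trivial⟩

/-- Kernels are continuous, so values on a countable dense set determine them. This embeds the space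
in `ℕ → unitInterval`, which is small in every universe. -/
theorem small [SecondCountableTopology G] [SecondCountableTopology H]
    (hW : Tendsto W (𝓝 1) (𝓝 0)) (hV : Tendsto V (𝓝 1) (𝓝 0)) :
    Small.{w} (CouplingSpace K L W V A) := by
  let s := TopologicalSpace.denseSeq (G × H)
  refine small_of_injective
    (f := fun (f : CouplingSpace K L W V A) (n : ℕ) => f.1 (s n).1 (s n).2) fun f g hfg => ?_
  have hc (f : CouplingSpace K L W V A) : Continuous fun p : G × H => f.1 p.1 p.2 :=
    (continuous_eval hW hV).comp (by fun_prop : Continuous fun p : G × H => (f, p))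
  have := (TopologicalSpace.denseRange_denseSeq (G × H)).equalizer (hc f) (hc g) hfg
  exact Subtype.ext <| funext fun x => funext fun y => congrFun this (x, y)

/-- The space of nonzero coarse kernels is a topological coupling. -/
theorem isTopologicalCoupling [T2Space G] [T2Space H] (hK : IsCompact K)
    (hKgen : Subgroup.closure K = ⊤) (hL : IsCompact L) (hLgen : Subgroup.closure L = ⊤)
    (hW : Tendsto W (𝓝 1) (𝓝 0)) (hV : Tendsto V (𝓝 1) (𝓝 0))
    (hne : Nonempty (CouplingSpace K L W V A)) :
    IsTopologicalCoupling G H (CouplingSpace K L W V A) := by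
  have hclosed := isClosed_setOf_isCoarseKernel hK hKgen hL hLgen hW hV A
  have hleft : Continuous fun p : G × CouplingSpace K L W V A => p.1 • p.2 := by
    refine Continuous.subtype_mk (continuous_pi fun x => continuous_pi fun y => ?_) _
    exact (continuous_eval hW hV).comp (by fun_prop :
      Continuous fun p : G × CouplingSpace K L W V A => (p.2, p.1⁻¹ * x, y))
  have hright : Continuous fun p : CouplingSpace K L W V A × H => MulOpposite.op p.2 • p.1 := by
    refine Continuous.subtype_mk (continuous_pi fun x => continuous_pi fun y => ?_) _
    exact (continuous_eval hW hV).comp (by fun_prop :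
      Continuous fun p : CouplingSpace K L W V A × H => (p.1, x, p.2 * y))
  refine
    { nonempty := hne
      t2Space := inferInstance
      locallyCompactSpace := ?_
      continuous_left := hleft
      continuous_right := hright
      comm := fun g h f => rfl
      proper_left := fun C hC => ?_
      proper_right := fun C hC => ?_
      cocompact := ⟨{f | f.1 1 1 = 1}, ?_, ?_, ?_⟩ }
  -- The space is the intersection of a closed and an open subset of a compact Hausdorff cube.
  · have hopen : IsOpen {f : G → H → unitInterval | ∃ x y, f x y ≠ 0} := by
      simp only [Set.ofPred_exists]
      exact isOpen_iUnion fun x => isOpen_iUnion fun y =>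
        isOpen_ne_fun (by fun_prop) continuous_const
    exact (hclosed.isLocallyClosed.inter hopen.isLocallyClosed).locallyCompactSpace
  · obtain ⟨n, hn⟩ := exists_wordLength_le_of_isCompact hC
    have hset : {g : G | ((g • C) ∩ C).Nonempty} = {g : G | ∃ c ∈ C, g • c ∈ C} := by
      ext g
      constructor
      · rintro ⟨_, ⟨c, hc, rfl⟩, hc'⟩
        exact ⟨c, hc, hc'⟩
      · rintro ⟨c, hc, hc'⟩
        exact ⟨_, ⟨c, hc, rfl⟩, hc'⟩
    rw [hset]
    -- The kernel `f` is nonzero at `(1, y)` and at `(g⁻¹, y')` with `y`, `y'` of length at most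
    -- `n`, so coarseness bounds the length of `g`.
    refine (isCompact_setOf_wordLength_le hK hKgen (A * (n + n) + A)).of_isClosed_subset
      (isClosed_setOf_exists_mem_compact hleft hC) ?_
    rintro g ⟨f, hf, hgf⟩
    obtain ⟨y, hy, hfy⟩ := hn f hf
    obtain ⟨y', hy', hfy'⟩ := hn _ hgf
    have h := (f.2.1.coarse _ _ _ _ hfy' hfy).2
    have h' := wordLength_mul_le hLgen y'⁻¹ y
    rw [wordLength_inv hLgen] at h'
    simp only [mul_one, inv_inv] at h
    exact h.trans (by gcongr; omega)
  · obtain ⟨n, hn⟩ := exists_wordLength_le_of_isCompact hC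
    have hset : {h : H | ((MulOpposite.op h • C) ∩ C).Nonempty} =
        {h : H | ∃ c ∈ C, MulOpposite.op h • c ∈ C} := by
      ext g
      constructor
      · rintro ⟨_, ⟨c, hc, rfl⟩, hc'⟩
        exact ⟨c, hc, hc'⟩
      · rintro ⟨c, hc, hc'⟩
        exact ⟨_, ⟨c, hc, rfl⟩, hc'⟩
    rw [hset]
    -- The kernel `f` is nonzero at `(1, y)` and `(1, h * y')`, in the same row, so `y⁻¹ * (h * y')`
    -- has length at most `A`; the two `n` come from `y` and `y'`.
    refine (isCompact_setOf_wordLength_le hL hLgen (n + A + n)).of_isClosed_subset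
      (isClosed_setOf_exists_mem_compact (hright.comp continuous_swap) hC) ?_
    rintro h ⟨f, hf, hhf⟩
    obtain ⟨y, hy, hfy⟩ := hn f hf
    obtain ⟨y', hy', hfy'⟩ := hn _ hhf
    have h1 := (f.2.1.coarse _ _ _ _ hfy hfy').1
    rw [inv_mul_cancel, wordLength_one, mul_zero, zero_add] at h1
    have h2 := wordLength_mul_le hLgen y (y⁻¹ * (h * y'))
    have h3 := wordLength_mul_le hLgen (y * (y⁻¹ * (h * y'))) y'⁻¹
    rw [wordLength_inv hLgen, mul_inv_cancel_left, mul_inv_cancel_right] at h3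
    rw [mul_inv_cancel_left] at h2
    have h1 : wordLength L (y⁻¹ * (h * y')) ≤ A := h1
    simp only [Set.mem_ofPred_eq]
    omega
  -- The condition `f 1 1 = 1` already excludes the zero kernel, so this set is closed in the whole
  -- cube.
  · rw [Subtype.isCompact_iff]
    have hc : IsClosed ({f : G → H → unitInterval | IsCoarseKernel K L W V A f} ∩
        {f | f 1 1 = 1}) :=
      hclosed.inter (isClosed_eq (by fun_prop) continuous_const)
    convert hc.isCompact using 1
    ext f
    constructor
    · rintro ⟨f, hf, rfl⟩
      exact ⟨f.2.1, hf⟩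
    · rintro ⟨hf, h1⟩
      have h1 : f 1 1 = 1 := h1
      exact ⟨⟨f, hf, 1, 1, by simp [h1]⟩, h1, rfl⟩
  · refine Set.eq_univ_of_forall fun f => ?_
    obtain ⟨x, hx⟩ := f.exists_eq_one_left 1
    refine Set.mem_iUnion.2 ⟨x, Set.mem_smul_set_iff_inv_smul_mem.2 ?_⟩
    simpa [smul_apply] using hx
  · refine Set.eq_univ_of_forall fun f => ?_
    obtain ⟨y, hy⟩ := f.exists_eq_one_right 1
    refine Set.mem_iUnion.2 ⟨y⁻¹, Set.mem_smul_set_iff_inv_smul_mem.2 ?_⟩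
    rw [← MulOpposite.op_inv, inv_inv]
    simpa [op_smul_apply] using hy

end CouplingSpace

/-! ### Change of universe. -/

/-- A coupling on a small space can be moved to any universe in which the space is small. -/
theorem IsTopologicalCoupling.admitTopologicalCoupling {G : Type u} {H : Type v} {X : Type*}
    [Group G] [TopologicalSpace G] [Group H] [TopologicalSpace H] [TopologicalSpace X]
    [MulAction G X] [MulAction Hᵐᵒᵖ X] [Small.{w} X] (hX : IsTopologicalCoupling G H X) :
    AdmitTopologicalCoupling.{u, v, w} G H := by
  let e : Shrink.{w} X ≃ X := (equivShrink X).symm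
  let _ : TopologicalSpace (Shrink.{w} X) := .induced e inferInstance
  let _ : MulAction G (Shrink.{w} X) := e.mulAction G
  let _ : MulAction Hᵐᵒᵖ (Shrink.{w} X) := e.mulAction Hᵐᵒᵖ
  let E : Shrink.{w} X ≃ₜ X := e.toHomeomorphOfIsInducing ⟨rfl⟩
  have hG (g : G) (x : Shrink.{w} X) : E (g • x) = g • E x := e.apply_symm_apply _
  have hH (h : H) (x : Shrink.{w} X) : E (MulOpposite.op h • x) = MulOpposite.op h • E x :=
    e.apply_symm_apply _
  have hGC (g : G) (C : Set (Shrink.{w} X)) : E '' (g • C) = g • E '' C :=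
    Set.image_smul_comm _ _ _ (hG g)
  have hHC (h : H) (C : Set (Shrink.{w} X)) :
      E '' (MulOpposite.op h • C) = MulOpposite.op h • E '' C :=
    Set.image_smul_comm _ _ _ (hH h)
  have := hX.nonempty
  have := hX.t2Space
  have := hX.locallyCompactSpace
  refine ⟨Shrink.{w} X, inferInstance, inferInstance, inferInstance,
    { nonempty := E.toEquiv.nonempty
      t2Space := E.isEmbedding.t2Space
      locallyCompactSpace := E.isOpenEmbedding.locallyCompactSpace
      continuous_left := ?_
      continuous_right := ?_
      comm := fun g h x => E.injective (by simp only [hG, hH, hX.comm])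
      proper_left := fun C hC => ?_
      proper_right := fun C hC => ?_
      cocompact := ?_ }⟩
  · rw [← E.comp_continuous_iff]
    refine (hX.continuous_left.comp (by fun_prop : Continuous fun p : G × Shrink.{w} X =>
      (p.1, E p.2))).congr fun p => (hG _ _).symm
  · rw [← E.comp_continuous_iff]
    refine (hX.continuous_right.comp (by fun_prop : Continuous fun p : Shrink.{w} X × H =>
      (E p.1, p.2))).congr fun p => (hH _ _).symm
  · convert hX.proper_left _ (hC.image E.continuous) using 3 with g
    rw [← hGC, ← Set.image_inter E.injective, Set.image_nonempty]
  · convert hX.proper_right _ (hC.image E.continuous) using 3 with h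
    rw [← hHC, ← Set.image_inter E.injective, Set.image_nonempty]
  · obtain ⟨C, hC, h1, h2⟩ := hX.cocompact
    have hEC : E '' (E.symm '' C) = C := by simp [Set.image_image]
    refine ⟨E.symm '' C, hC.image E.symm.continuous, ?_, ?_⟩
    · apply E.injective.image_injective
      rw [Set.image_iUnion, Set.image_univ_of_surjective E.surjective, ← h1]
      simp only [hGC, hEC]
    · apply E.injective.image_injective
      rw [Set.image_iUnion, Set.image_univ_of_surjective E.surjective, ← h2]
      simp only [hHC, hEC]

/-! ### Bump functions and the kernel of a quasi-isometry. -/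

/-- A compactly supported continuous function on a topological group is uniformly continuous with
respect to right translations. -/
theorem HasCompactSupport.eventually_forall_abs_mul_sub_lt {G : Type*} [Group G]
    [TopologicalSpace G] [IsTopologicalGroup G] {f : G → ℝ} (hf : Continuous f)
    (hfc : HasCompactSupport f) {ε : ℝ} (hε : 0 < ε) :
    ∀ᶠ u in 𝓝 (1 : G), ∀ z, |f (z * u) - f z| < ε := by
  have h : ∀ᶠ u in 𝓝 (1 : G), ∀ z ∈ tsupport f, |f (z * u) - f z| < ε := by
    refine hfc.isCompact.eventually_forall_of_forall_eventually fun z _ => ?_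
    have hc : Continuous fun p : G × G => |f (p.2 * p.1) - f p.2| := by fun_prop
    exact hc.continuousAt.eventually_lt continuousAt_const (by simpa using hε)
  -- A point `z` outside the support with `z * u` inside is handled by applying the estimate at `z *
  -- u` with `u⁻¹`.
  have hinv : Tendsto (fun u : G => u⁻¹) (𝓝 1) (𝓝 1) := by
    simpa using (continuous_inv (G := G)).tendsto 1
  filter_upwards [h, hinv.eventually h] with u hu hu' z
  by_cases hz : z ∈ tsupport f
  · exact hu z hz
  by_cases hzu : z * u ∈ tsupport f
  · simpa [abs_sub_comm] using hu' _ hzu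
  · simpa [image_eq_zero_of_notMem_tsupport hz, image_eq_zero_of_notMem_tsupport hzu] using hε

/-- A bump function on a locally compact group, with a left-invariant modulus of continuity. -/
theorem exists_bump_with_modulus {G : Type*} [Group G] [TopologicalSpace G] [IsTopologicalGroup G]
    [LocallyCompactSpace G] {S : Set G} (hS : IsCompact S) :
    ∃ (f : G → ℝ) (W : G → ℝ), (∀ x, f x ∈ Set.Icc (0 : ℝ) 1) ∧ (∀ x ∈ S, f x = 1) ∧
      HasCompactSupport f ∧ Tendsto W (𝓝 1) (𝓝 0) ∧ ∀ x x', |f x - f x'| ≤ W (x⁻¹ * x') := by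
  obtain ⟨f, hf1, -, hfc, hf⟩ :=
    exists_continuous_one_zero_of_isCompact hS isClosed_empty (Set.disjoint_empty S)
  have hle (u z : G) : |f (z * u) - f z| ≤ 1 := by
    rw [abs_le]
    constructor <;> linarith [(hf z).1, (hf z).2, (hf (z * u)).1, (hf (z * u)).2]
  refine ⟨f, fun u => ⨆ z, |f (z * u) - f z|, hf, hf1, hfc, ?_, fun x x' => ?_⟩
  · rw [Metric.tendsto_nhds]
    intro ε hε
    filter_upwards [hfc.eventually_forall_abs_mul_sub_lt f.continuous (half_pos hε)] with u hu
    rw [Real.dist_eq, sub_zero, abs_of_nonneg (Real.iSup_nonneg fun _ => abs_nonneg _)]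
    exact (ciSup_le fun z => (hu z).le).trans_lt (half_lt_self hε)
  · have := le_ciSup (f := fun z => |f (z * (x⁻¹ * x')) - f z|)
      ⟨1, by rintro _ ⟨z, rfl⟩; exact hle _ z⟩ x
    rwa [mul_inv_cancel_left, abs_sub_comm] at this

theorem abs_ciSup_sub_ciSup_le {ι : Type*} [Nonempty ι] {F F' : ι → ℝ} {c : ℝ}
    (hF : BddAbove (Set.range F)) (hF' : BddAbove (Set.range F'))
    (h : ∀ i, |F i - F' i| ≤ c) : |(⨆ i, F i) - ⨆ i, F' i| ≤ c := by
  rw [abs_sub_le_iff, sub_le_iff_le_add, sub_le_iff_le_add]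
  refine ⟨ciSup_le fun i => ?_, ciSup_le fun i => ?_⟩
  · linarith [(abs_sub_le_iff.1 (h i)).1, le_ciSup hF' i]
  · linarith [(abs_sub_le_iff.1 (h i)).2, le_ciSup hF i]

theorem abs_mul_sub_mul_le_add {a b a' b' : ℝ} (hb : b ∈ Set.Icc (0 : ℝ) 1)
    (ha' : a' ∈ Set.Icc (0 : ℝ) 1) : |a * b - a' * b'| ≤ |a - a'| + |b - b'| := by
  calc |a * b - a' * b'| = |(a - a') * b + a' * (b - b')| := by ring_nf
    _ ≤ |(a - a') * b| + |a' * (b - b')| := abs_add_le _ _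
    _ ≤ |a - a'| + |b - b'| := by
      rw [abs_mul, abs_mul, abs_of_nonneg hb.1, abs_of_nonneg ha'.1]
      exact add_le_add (mul_le_of_le_one_right (abs_nonneg _) hb.2)
        (mul_le_of_le_one_left (abs_nonneg _) ha'.2)

theorem IsQuasiIsometry.exists_nat_bound {G : Type u} {H : Type v} [Group G] [Group H] {K : Set G}
    {L : Set H} {φ : G → H} (hφ : IsQuasiIsometry (wordDist K) (wordDist L) φ) :
    ∃ N : ℕ, (∀ x z, wordLength L ((φ x)⁻¹ * φ z) ≤ N * wordLength K (x⁻¹ * z) + N ∧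
      wordLength K (x⁻¹ * z) ≤ N * wordLength L ((φ x)⁻¹ * φ z) + N) ∧
      ∀ y, ∃ x, wordLength L (y⁻¹ * φ x) ≤ N := by
  obtain ⟨l, C, hl, hC, h, hcob⟩ := hφ
  -- The lower bound rearranges to `d ≤ l * d' + l * C`; hence the term `l * C`.
  have hlN := Nat.le_ceil (l * C + l + C)
  have hlC : 0 ≤ l * C := by positivity
  generalize ⌈l * C + l + C⌉₊ = N at hlN
  refine ⟨N, fun x z => ?_, fun y => ?_⟩
  · obtain ⟨h1, h2⟩ := h x z
    have hd : 0 ≤ wordDist K x z := Nat.cast_nonneg _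
    have hd' : 0 ≤ wordDist L (φ x) (φ z) := Nat.cast_nonneg _
    constructor
    · have : wordDist L (φ x) (φ z) ≤ N * wordDist K x z + N := by
        nlinarith [mul_le_mul_of_nonneg_right (by linarith : l ≤ N) hd]
      unfold wordDist at this
      exact_mod_cast this
    · have : wordDist K x z ≤ N * wordDist L (φ x) (φ z) + N := by
        rw [sub_le_iff_le_add, inv_mul_le_iff₀ (by linarith)] at h1
        nlinarith [mul_le_mul_of_nonneg_right (by linarith : l ≤ N) hd']
      unfold wordDist at this
      exact_mod_cast this
  · obtain ⟨x, hx⟩ := hcob y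
    have : wordDist L y (φ x) ≤ N := by linarith
    unfold wordDist at this
    exact ⟨x, by exact_mod_cast this⟩

/-- A quasi-isometry between compactly generated locally compact groups gives a nonzero coarse
kernel, namely a bump function around its graph. -/
theorem IsQuasiIsometry.exists_couplingSpace_nonempty {G : Type u} {H : Type v}
    [Group G] [TopologicalSpace G] [IsTopologicalGroup G] [T2Space G] [LocallyCompactSpace G]
    [Group H] [TopologicalSpace H] [IsTopologicalGroup H] [T2Space H] [LocallyCompactSpace H]
    {K : Set G} (hK : IsCompact K) (hKgen : Subgroup.closure K = ⊤)
    {L : Set H} (hL : IsCompact L) (hLgen : Subgroup.closure L = ⊤)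
    {φ : G → H} (hφ : IsQuasiIsometry (wordDist K) (wordDist L) φ) :
    ∃ (W : G → ℝ) (V : H → ℝ) (A : ℕ), Tendsto W (𝓝 1) (𝓝 0) ∧ Tendsto V (𝓝 1) (𝓝 0) ∧
      Nonempty (CouplingSpace K L W V A) := by
  obtain ⟨N, hN, hcob⟩ := hφ.exists_nat_bound
  obtain ⟨p, W, hp, hp1, hpc, hW, hpW⟩ := exists_bump_with_modulus (isCompact_singleton (x := (1 : G)))
  -- Having `q = 1` on the whole ball of radius `N`, the coboundedness constant, makes the kernel
  -- attain `1` in every column.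
  obtain ⟨q, V, hq, hq1, hqc, hV, hqV⟩ :=
    exists_bump_with_modulus (isCompact_setOf_wordLength_le hL hLgen N)
  obtain ⟨R₁, hR₁⟩ := IsCompact.exists_wordLength_le hK hKgen hpc.isCompact
  obtain ⟨R₂, hR₂⟩ := IsCompact.exists_wordLength_le hL hLgen hqc.isCompact
  -- A product bump centred at the graph point `(a, φ a)`. All these bumps share the left-invariant
  -- moduli `W` and `V`, so their supremum over `a` has them too, although `φ` need not be
  -- continuous.
  let F (x : G) (y : H) (a : G) : ℝ := p (a⁻¹ * x) * q ((φ a)⁻¹ * y)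
  have hF0 x y a : 0 ≤ F x y a := mul_nonneg (hp _).1 (hq _).1
  have hF1 x y a : F x y a ≤ 1 := mul_le_one₀ (hp _).2 (hq _).1 (hq _).2
  have hbdd x y : BddAbove (Set.range (F x y)) := ⟨1, by rintro _ ⟨a, rfl⟩; exact hF1 x y a⟩
  let f (x : G) (y : H) : unitInterval :=
    ⟨⨆ a, F x y a, Real.iSup_nonneg (hF0 x y), ciSup_le (hF1 x y)⟩
  have hf1 {x y} (h : wordLength L ((φ x)⁻¹ * y) ≤ N) : f x y = 1 := by
    refine Subtype.ext (le_antisymm (ciSup_le (hF1 x y)) ?_)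
    have := le_ciSup (hbdd x y) x
    simpa [F, hp1, hq1 _ h] using this
  have hfne {x y} (h : f x y ≠ 0) :
      ∃ a, wordLength K (a⁻¹ * x) ≤ R₁ ∧ wordLength L ((φ a)⁻¹ * y) ≤ R₂ := by
    by_contra! hcon
    refine h (Subtype.ext ?_)
    have hz : F x y = fun _ => 0 := by
      funext a
      by_cases ha : a⁻¹ * x ∈ tsupport p
      · have hq0 : (φ a)⁻¹ * y ∉ tsupport q := fun hmem =>
          (hcon a (hR₁ _ ha)).not_ge (hR₂ _ hmem)
        simp [F, image_eq_zero_of_notMem_tsupport hq0]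
      · simp [F, image_eq_zero_of_notMem_tsupport ha]
    simp [f, hz]
  -- Passing to nearby graph points and back gives `N * (d + 2 * R₁) + N + 2 * R₂` and the same with
  -- `R₁`, `R₂` exchanged; this constant dominates both.
  refine ⟨W, V, N + 2 * R₁ + 2 * R₂ + N * (2 * R₁ + 2 * R₂), hW, hV, ⟨f, ⟨?_, ?_, ?_, ?_⟩, ?_⟩⟩
  · intro x y x' y'
    refine abs_ciSup_sub_ciSup_le (hbdd x y) (hbdd x' y') fun a => ?_
    refine (abs_mul_sub_mul_le_add (hq _) (hp _)).trans (add_le_add ?_ ?_)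
    · simpa [mul_assoc] using hpW (a⁻¹ * x) (a⁻¹ * x')
    · simpa [mul_assoc] using hqV ((φ a)⁻¹ * y) ((φ a)⁻¹ * y')
  · intro x y x' y' h h'
    obtain ⟨a, hax, hay⟩ := hfne h
    obtain ⟨a', hax', hay'⟩ := hfne h'
    obtain ⟨h1, h2⟩ := hN a a'
    have e1 := wordLength_inv_mul_le hKgen a x a'
    have e2 := wordLength_inv_mul_le hKgen x x' a'
    have e3 := wordLength_inv_mul_le hKgen x a x'
    have e4 := wordLength_inv_mul_le hKgen a a' x'
    have e5 := wordLength_inv_mul_le hLgen (φ a) y (φ a')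
    have e6 := wordLength_inv_mul_le hLgen y y' (φ a')
    have e7 := wordLength_inv_mul_le hLgen y (φ a) y'
    have e8 := wordLength_inv_mul_le hLgen (φ a) (φ a') y'
    rw [wordLength_inv_mul_comm hKgen x' a'] at e2
    rw [wordLength_inv_mul_comm hKgen x a] at e3
    rw [wordLength_inv_mul_comm hLgen y' (φ a')] at e6
    rw [wordLength_inv_mul_comm hLgen y (φ a)] at e7
    constructor
    · have : wordLength K (a⁻¹ * a') ≤ wordLength K (x⁻¹ * x') + 2 * R₁ := by omega
      calc _ ≤ N * wordLength K (a⁻¹ * a') + N + 2 * R₂ := by omega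
        _ ≤ N * (wordLength K (x⁻¹ * x') + 2 * R₁) + N + 2 * R₂ := by gcongr
        _ ≤ _ := by
          generalize wordLength K (x⁻¹ * x') = d
          ring_nf
          nlinarith [Nat.zero_le (R₁ * d), Nat.zero_le (R₂ * d), Nat.zero_le (N * R₁ * d),
            Nat.zero_le (N * R₂ * d), Nat.zero_le (N * R₂)]
    · have : wordLength L ((φ a)⁻¹ * φ a') ≤ wordLength L (y⁻¹ * y') + 2 * R₂ := by omega
      calc _ ≤ N * wordLength L ((φ a)⁻¹ * φ a') + N + 2 * R₁ := by omega
        _ ≤ N * (wordLength L (y⁻¹ * y') + 2 * R₂) + N + 2 * R₁ := by gcongr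
        _ ≤ _ := by
          generalize wordLength L (y⁻¹ * y') = d
          ring_nf
          nlinarith [Nat.zero_le (R₁ * d), Nat.zero_le (R₂ * d), Nat.zero_le (N * R₁ * d),
            Nat.zero_le (N * R₂ * d), Nat.zero_le (N * R₁)]
  · exact fun x y x' _ => ⟨φ x', hf1 (by simp [wordLength_one])⟩
  · intro x y y' _
    obtain ⟨x', hx'⟩ := hcob y'
    exact ⟨x', hf1 (by rwa [wordLength_inv_mul_comm hLgen])⟩
  · exact ⟨1, φ 1, by simp [hf1 (x := 1) (y := φ 1) (by simp [wordLength_one])]⟩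

theorem mainTheorem2 (G : Type u) (H : Type v)
    [Group G] [TopologicalSpace G] [IsTopologicalGroup G] [T2Space G]
    [LocallyCompactSpace G] [SecondCountableTopology G]
    [Group H] [TopologicalSpace H] [IsTopologicalGroup H] [T2Space H]
    [LocallyCompactSpace H] [SecondCountableTopology H]
    (K : Set G) (hK : IsCompact K) (hKgen : Subgroup.closure K = ⊤)
    (L : Set H) (hL : IsCompact L) (hLgen : Subgroup.closure L = ⊤) :
    (∃ φ : G → H, IsQuasiIsometry (wordDist K) (wordDist L) φ) ↔
      AdmitTopologicalCoupling.{u, v, w} G H := by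
  constructor
  · rintro ⟨φ, hφ⟩
    obtain ⟨W, V, A, hW, hV, hne⟩ := hφ.exists_couplingSpace_nonempty hK hKgen hL hLgen
    have : Small.{w} (CouplingSpace K L W V A) := CouplingSpace.small hW hV
    exact (CouplingSpace.isTopologicalCoupling hK hKgen hL hLgen hW hV
      hne).admitTopologicalCoupling
  · rintro ⟨X, _, _, _, hX⟩
    exact hX.exists_isQuasiIsometry hK hKgen hL hLgen
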